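/- Let $K$ be a field, let $A$ be a finite-dimensional $K$-algebra, and let $\mathrm{mod}A$ be the category of finitely generated left $A$-modules. For $Y\in\mathrm{mod}A$ let $\Omega^{-}Y$ be the cokernel of an injective envelope $Y\hookrightarrow I(Y)$, let $\tau^{-}=\mathrm{Tr}\,D$ be the inverse Auslander–Reiten translation, where $D=\mathrm{Hom}_K(-,K)$ and, for a finitely generated right $A$-module $M$ with minimal projective presentation $P_1\to P_0\to M\to 0$, $\mathrm{Tr}\,M$ is the cokernel of $\mathrm{Hom}_{A^{\mathrm{op}}}(P_0,A)\to\mathrm{Hom}_{A^{\mathrm{op}}}(P_1,A)$, and put $\tau_2^{-}Y:=\tau^{-}\Omega^{-}Y$. For $X\in\mathrm{mod}A$ let $\mathrm{Sub}X$ be the class of all $N\in\mathrm{mod}A$ that admit an injective homomorphism $N\hookrightarrow X$. Let $\underline{\mathrm{Hom}}_A(M,N)$ be the quotient of $\mathrm{Hom}_A(M,N)$ by the subgroup of homomorphisms that factor through a projective module in $\mathrm{mod}A$. Then for all $X,Y\in\mathrm{mod}A$ the following are equivalent: 1. $\mathrm{Hom}_A(\tau_2^{-}Y,X)=0$; 2.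 $\underline{\mathrm{Hom}}_A(\tau_2^{-}Y,N)=0$ for every $N\in\mathrm{Sub}X$; 3. $\mathrm{Ext}^2_A(N,Y)=0$ for every $N\in\mathrm{Sub}X$. -/

import Mathlib

universe u

/-! ### Minimal presentations over a ring -/

section Covers

variable (R : Type u) [Ring R] (M : Type u) [AddCommGroup M] [Module R M]

/-- A projective cover of `M` in the category of finitely generated `R`-modules: an epimorphism
from a finitely generated projective module whose kernel is superfluous. -/
structure ProjCover where
  carrier : Type u
  [addCommGroup : AddCommGroup carrier]
  [module : Module R carrier]
  [finite : Module.Finite R carrier]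
  [projective : Module.Projective R carrier]
  π : carrier →ₗ[R] M
  surjective : Function.Surjective π
  superfluous : ∀ L : Submodule R carrier, L ⊔ LinearMap.ker π = ⊤ → L = ⊤

/-- An injective envelope of `M` in the category of finitely generated `R`-modules: a monomorphism
into a finitely generated injective module whose image is essential. -/
structure InjEnvelope where
  carrier : Type u
  [addCommGroup : AddCommGroup carrier]
  [module : Module R carrier]
  [finite : Module.Finite R carrier]
  [inj : Module.Injective R carrier]
  ι : M →ₗ[R] carrier
  injective : Function.Injective ι
  essential : ∀ L : Submodule R carrier, L ⊓ LinearMap.range ι = ⊥ → L = ⊥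

end Covers

attribute [instance] ProjCover.addCommGroup ProjCover.module ProjCover.finite ProjCover.projective
attribute [instance] InjEnvelope.addCommGroup InjEnvelope.module InjEnvelope.finite InjEnvelope.inj

section Covers

variable (R : Type u) [Ring R] (M : Type u) [AddCommGroup M] [Module R M]

/-- A minimal projective presentation `P₁ ⟶ P₀ ⟶ M ⟶ 0`: `P₀` is a projective cover of `M` and
`P₁` is a projective cover of the kernel of `P₀ ⟶ M`. -/
structure MinProjPresentation where
  P₀ : ProjCover R M
  P₁ : ProjCover R (LinearMap.ker P₀.π)

end Covers

/-- The map `P₁ ⟶ P₀` of a minimal projective presentation. -/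
def MinProjPresentation.d {R : Type u} [Ring R] {M : Type u} [AddCommGroup M] [Module R M]
    (p : MinProjPresentation R M) : p.P₁.carrier →ₗ[R] p.P₀.carrier :=
  (LinearMap.ker p.P₀.π).subtype ∘ₗ p.P₁.π

/-! ### Existence of projective covers and injective envelopes -/

section Existence

/-- In a module of finite length, a property `Q` of submodules that holds for `⊤` holds for some
direct summand `N` all of whose endomorphisms with `Q` for the images of their powers are
bijective. -/
theorem exists_minimal_summand {R F : Type*} [Ring R] [AddCommGroup F] [Module R F]
    [IsArtinian R F] [IsNoetherian R F] (Q : Submodule R F → Prop) (hQ : Q ⊤) :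
    ∃ (N : Submodule R F) (r : F →ₗ[R] N), (∀ x : N, r x = x) ∧ Q N ∧
      ∀ h : Module.End R N, (∀ n, Q ((LinearMap.range (h ^ n)).map N.subtype)) →
        Function.Bijective h := by
  obtain ⟨N, ⟨⟨r, hr⟩, hN⟩, hmin⟩ := WellFounded.has_min
    (wellFounded_lt (α := Submodule R F))
    {N | (∃ r : F →ₗ[R] N, ∀ x : N, r x = x) ∧ Q N}
    ⟨⊤, ⟨LinearMap.id.codRestrict ⊤ (fun _ => trivial), fun x => rfl⟩, hQ⟩
  refine ⟨N, r, hr, hN, fun h hh => ?_⟩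
  obtain ⟨n, hn, hn0⟩ := ((LinearMap.eventually_isCompl_ker_pow_range_pow h).and
    (Filter.eventually_ge_atTop 1)).exists
  set U := LinearMap.range (h ^ n) with hU
  have hle : U.map N.subtype ≤ N := Submodule.map_subtype_le N U
  obtain ⟨s, hs⟩ : ∃ s : N →ₗ[R] U, ∀ x : U, s x = x :=
    ⟨Submodule.projectionOnto U _ hn.symm, fun x => by simp⟩
  have key : ∃ r : F →ₗ[R] (U.map N.subtype : Submodule R F),
      ∀ x : (U.map N.subtype : Submodule R F), r x = x := by
    refine ⟨(N.subtype.submoduleMap U) ∘ₗ s ∘ₗ r, ?_⟩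
    rintro ⟨_, x, hx, rfl⟩
    apply Subtype.ext
    have h1 := hr x
    have h2 := hs ⟨x, hx⟩
    simp only at h2
    simp [h1, h2]
  have hnot := hmin _ ⟨key, hh n⟩
  have heq : U.map N.subtype = N := by
    by_contra hne
    exact hnot (lt_of_le_of_ne hle hne)
  have htop : U = ⊤ := by
    rw [eq_top_iff]
    intro x _
    have : (x : F) ∈ U.map N.subtype := by rw [heq]; exact x.2
    obtain ⟨y, hy, hxy⟩ := this
    have : y = x := Subtype.ext hxy
    exact this ▸ hy
  have hsurj : Function.Surjective h := by
    intro y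
    have : y ∈ U := htop ▸ trivial
    obtain ⟨x, hx⟩ := this
    obtain ⟨m, rfl⟩ : ∃ m, n = m + 1 := ⟨n - 1, by omega⟩
    exact ⟨(h ^ m) x, by rw [← hx, pow_succ', Module.End.mul_apply]⟩
  exact ⟨IsNoetherian.injective_of_surjective_endomorphism h hsurj, hsurj⟩

theorem nonempty_projCover (R : Type u) [Ring R] [IsArtinianRing R] (M : Type u) [AddCommGroup M]
    [Module R M] [Module.Finite R M] : Nonempty (ProjCover R M) := by
  obtain ⟨n, p, hp⟩ := Module.Finite.exists_fin' R M
  obtain ⟨N, r, hr, hN, hbij⟩ := exists_minimal_summand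
    (fun N : Submodule R (Fin n → R) => N.map p = ⊤)
    (by rw [Submodule.map_top, LinearMap.range_eq_top.2 hp])
  have hfin : Module.Finite R N := Module.Finite.of_surjective r fun x => ⟨x, hr x⟩
  have hproj : Module.Projective R N :=
    Module.Projective.of_split N.subtype r (LinearMap.ext hr)
  have hs : Function.Surjective (p ∘ₗ N.subtype) := by
    intro m
    have : m ∈ N.map p := hN ▸ trivial
    obtain ⟨x, hx, rfl⟩ := this
    exact ⟨⟨x, hx⟩, rfl⟩
  refine ⟨{ carrier := N, π := p ∘ₗ N.subtype, surjective := hs, superfluous := ?_ }⟩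
  intro L hL
  have hLs : Function.Surjective ((p ∘ₗ N.subtype) ∘ₗ L.subtype) := by
    intro m
    obtain ⟨x, rfl⟩ := hs m
    have : x ∈ L ⊔ LinearMap.ker (p ∘ₗ N.subtype) := hL ▸ trivial
    obtain ⟨y, hy, z, hz, rfl⟩ := Submodule.mem_sup.1 this
    exact ⟨⟨y, hy⟩, by rw [map_add, LinearMap.mem_ker.1 hz, add_zero]; rfl⟩
  obtain ⟨h, hh⟩ := Module.projective_lifting_property _ (p ∘ₗ N.subtype) hLs
  have hh' : ∀ x : N, p ((h x : N) : Fin n → R) = p x := fun x => LinearMap.congr_fun hh x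
  have hb := hbij (L.subtype ∘ₗ h) (fun k => by
    rw [eq_top_iff]
    intro m _
    obtain ⟨x, rfl⟩ := hs m
    refine ⟨_, ⟨((L.subtype ∘ₗ h) ^ k) x, ⟨x, rfl⟩, rfl⟩, ?_⟩
    induction k with
    | zero => rfl
    | succ k ih =>
      rw [pow_succ', Module.End.mul_apply]
      exact (hh' _).trans ih)
  rw [eq_top_iff]
  intro x _
  obtain ⟨y, rfl⟩ := hb.2 x
  exact (h y).2

theorem nonempty_minProjPresentation (R : Type u) [Ring R] [IsArtinianRing R] (M : Type u)
    [AddCommGroup M] [Module R M] [Module.Finite R M] : Nonempty (MinProjPresentation R M) := by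
  obtain ⟨P₀⟩ := nonempty_projCover R M
  obtain ⟨P₁⟩ := nonempty_projCover R (LinearMap.ker P₀.π)
  exact ⟨⟨P₀, P₁⟩⟩

/-- The coinduced module `Hom_K(A, Y)` with `(b • f) a = f (a * b)`. -/
def Coinduced (K A Y : Type u) [Field K] [Ring A] [Algebra K A] [AddCommGroup Y] [Module K Y] :
    Type u := A →ₗ[K] Y

section Coinduced

variable (K A Y : Type u) [Field K] [Ring A] [Algebra K A] [AddCommGroup Y] [Module K Y]

instance Coinduced.instAddCommGroup : AddCommGroup (Coinduced K A Y) :=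
  inferInstanceAs (AddCommGroup (A →ₗ[K] Y))

instance Coinduced.instModuleBase : Module K (Coinduced K A Y) :=
  inferInstanceAs (Module K (A →ₗ[K] Y))

instance Coinduced.instModule : Module A (Coinduced K A Y) where
  smul b f := LinearMap.comp (show A →ₗ[K] Y from f) (LinearMap.mulRight K b)
  one_smul f := LinearMap.ext fun a => congrArg (show A →ₗ[K] Y from f) (mul_one a)
  mul_smul b c f :=
    LinearMap.ext fun a => congrArg (show A →ₗ[K] Y from f) (mul_assoc a b c).symm
  smul_zero _ := rfl
  smul_add _ _ _ := rfl
  add_smul b c f := LinearMap.ext fun a =>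
    (congrArg (show A →ₗ[K] Y from f) (mul_add a b c)).trans
      (map_add (show A →ₗ[K] Y from f) _ _)
  zero_smul f := LinearMap.ext fun a =>
    (congrArg (show A →ₗ[K] Y from f) (mul_zero a)).trans (map_zero (show A →ₗ[K] Y from f))

instance Coinduced.instIsScalarTower : IsScalarTower K A (Coinduced K A Y) where
  smul_assoc k b f := LinearMap.ext fun a =>
    (congrArg (show A →ₗ[K] Y from f) (mul_smul_comm k a b)).trans
      (map_smul (show A →ₗ[K] Y from f) k (a * b))

theorem Coinduced.finite [FiniteDimensional K A] [FiniteDimensional K Y] :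
    Module.Finite A (Coinduced K A Y) := by
  have : Module.Finite K (Coinduced K A Y) := inferInstanceAs (Module.Finite K (A →ₗ[K] Y))
  exact Module.Finite.of_restrictScalars_finite K A _

theorem Coinduced.module_injective : Module.Injective A (Coinduced K A Y) where
  out V W _ _ _ _ f hf g := by
    let _ : Module K V := Module.compHom V (algebraMap K A)
    let _ : Module K W := Module.compHom W (algebraMap K A)
    have : IsScalarTower K A V := ⟨fun k a v => by
      rw [Algebra.smul_def, mul_smul]; rfl⟩
    have : IsScalarTower K A W := ⟨fun k a v => by
      rw [Algebra.smul_def, mul_smul]; rfl⟩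
    obtain ⟨s, hs⟩ := (f.restrictScalars K).exists_leftInverse_of_injective
      (LinearMap.ker_eq_bot.2 hf)
    have hs' : ∀ v, s (f v) = v := fun v => LinearMap.congr_fun hs v
    let ev : Coinduced K A Y →ₗ[K] Y :=
      { toFun := fun φ => (show A →ₗ[K] Y from φ) 1
        map_add' := fun _ _ => rfl
        map_smul' := fun _ _ => rfl }
    let t : W →ₗ[K] Y := ev ∘ₗ (g.restrictScalars K) ∘ₗ s
    let h : W →ₗ[A] Coinduced K A Y :=
      { toFun := fun w => (t ∘ₗ (LinearMap.toSpanSingleton A W w).restrictScalars K : A →ₗ[K] Y)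
        map_add' := fun w w' => LinearMap.ext fun a =>
          (congrArg t (smul_add a w w')).trans (map_add t _ _)
        map_smul' := fun b w => LinearMap.ext fun a => congrArg t (mul_smul a b w).symm }
    refine ⟨h, fun v => LinearMap.ext fun a => ?_⟩
    have e : h (f v) = (t ∘ₗ (LinearMap.toSpanSingleton A W (f v)).restrictScalars K :
      A →ₗ[K] Y) := rfl
    rw [e]
    change ev (g (s (a • f v))) = _
    rw [← map_smul f, hs', map_smul g]
    exact congrArg (show A →ₗ[K] Y from g v) (one_mul a)

end Coinduced

theorem nonempty_injEnvelope (K A : Type u) [Field K] [Ring A] [Algebra K A]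
    [FiniteDimensional K A] (Y : Type u) [AddCommGroup Y] [Module K Y] [Module A Y]
    [IsScalarTower K A Y] [Module.Finite A Y] : Nonempty (InjEnvelope A Y) := by
  have : FiniteDimensional K Y := Module.Finite.trans A Y
  have : Module.Finite A (Coinduced K A Y) := Coinduced.finite K A Y
  have hinj : Module.Injective A (Coinduced K A Y) := Coinduced.module_injective K A Y
  have : IsArtinianRing A := IsArtinianRing.of_finite K A
  let j : Y →ₗ[A] Coinduced K A Y :=
    { toFun := fun y => ((LinearMap.toSpanSingleton A Y y).restrictScalars K : A →ₗ[K] Y)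
      map_add' := fun y y' => LinearMap.ext fun a => smul_add a y y'
      map_smul' := fun b y => LinearMap.ext fun a => (mul_smul a b y).symm }
  have hj : Function.Injective j := fun y y' h => by
    have := LinearMap.congr_fun (show ((LinearMap.toSpanSingleton A Y y).restrictScalars K :
      A →ₗ[K] Y) = (LinearMap.toSpanSingleton A Y y').restrictScalars K from h) 1
    simpa using this
  obtain ⟨N, r, hr, hN, hbij⟩ := exists_minimal_summand
    (fun N : Submodule A (Coinduced K A Y) => LinearMap.range j ≤ N) le_top
  have hfin : Module.Finite A N := Module.Finite.of_surjective r fun x => ⟨x, hr x⟩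
  have hNinj : Module.Injective A N := ⟨fun V W _ _ _ _ f hf g => by
    obtain ⟨h, hh⟩ := hinj.out f hf (N.subtype ∘ₗ g)
    exact ⟨r ∘ₗ h, fun v => by simp [hh, hr]⟩⟩
  let i : Y →ₗ[A] N := j.codRestrict N fun y => hN ⟨y, rfl⟩
  have hi : Function.Injective i := fun y y' h => hj (congrArg Subtype.val h)
  refine ⟨{ carrier := N, ι := i, injective := hi, essential := ?_ }⟩
  intro L hL
  have hq : Function.Injective (L.mkQ ∘ₗ i) := by
    rw [← LinearMap.ker_eq_bot, eq_bot_iff]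
    intro y hy
    have h1 : i y ∈ L := by simpa using hy
    have h2 : i y ∈ L ⊓ LinearMap.range i := ⟨h1, y, rfl⟩
    rw [hL, Submodule.mem_bot] at h2
    exact hi (h2.trans (map_zero i).symm)
  obtain ⟨h, hh⟩ := hNinj.out (L.mkQ ∘ₗ i) hq i
  have hb := hbij (h ∘ₗ L.mkQ) (fun k => by
    rintro _ ⟨y, rfl⟩
    refine ⟨i y, ⟨i y, ?_⟩, rfl⟩
    induction k with
    | zero => rfl
    | succ k ih =>
      rw [pow_succ', Module.End.mul_apply, ih]
      exact hh y)
  rw [eq_bot_iff]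
  intro x hx
  have : (h ∘ₗ L.mkQ) x = (h ∘ₗ L.mkQ) 0 := by
    simp [(Submodule.Quotient.mk_eq_zero L).2 hx]
  exact (Submodule.mem_bot A).2 (hb.1 this)

end Existence

/-! ### The duality `D = Hom_K(-, K)` -/

/-- `D Y = Hom_K(Y, K)`. For a left `A`-module `Y` this is a right `A`-module, that is, a module
over `Aᵐᵒᵖ`, with `(f · a) y = f (a • y)`. -/
def KDual (K Y : Type u) [Field K] [AddCommGroup Y] [Module K Y] : Type u := Y →ₗ[K] K

section KDual

variable (K A Y : Type u) [Field K] [Ring A] [Algebra K A] [AddCommGroup Y] [Module K Y]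
  [Module A Y] [IsScalarTower K A Y]

instance KDual.instAddCommGroup : AddCommGroup (KDual K Y) :=
  inferInstanceAs (AddCommGroup (Y →ₗ[K] K))

instance KDual.instModuleBase : Module K (KDual K Y) :=
  inferInstanceAs (Module K (Y →ₗ[K] K))

instance KDual.instModule : Module Aᵐᵒᵖ (KDual K Y) where
  smul a f := LinearMap.comp (show Y →ₗ[K] K from f) (Algebra.lsmul K K Y a.unop)
  one_smul f := LinearMap.ext fun y => congrArg (show Y →ₗ[K] K from f) (one_smul A y)
  mul_smul a b f :=
    LinearMap.ext fun y => congrArg (show Y →ₗ[K] K from f) (mul_smul b.unop a.unop y)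
  smul_zero _ := rfl
  smul_add _ _ _ := rfl
  add_smul a b f := LinearMap.ext fun y =>
    (congrArg (show Y →ₗ[K] K from f) (add_smul a.unop b.unop y)).trans
      (map_add (show Y →ₗ[K] K from f) _ _)
  zero_smul f := LinearMap.ext fun y =>
    (congrArg (show Y →ₗ[K] K from f) (zero_smul A y)).trans (map_zero (show Y →ₗ[K] K from f))

theorem KDual.smul_apply (a : Aᵐᵒᵖ) (f : KDual K Y) (y : Y) :
    (show Y →ₗ[K] K from a • f) y = (show Y →ₗ[K] K from f) (a.unop • y) := rfl

instance KDual.instIsScalarTower : IsScalarTower K Aᵐᵒᵖ (KDual K Y) where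
  smul_assoc k a f := LinearMap.ext fun y =>
    (congrArg (show Y →ₗ[K] K from f) (smul_assoc k a.unop y)).trans
      (map_smul (show Y →ₗ[K] K from f) k (a.unop • y))

theorem KDual.finite [FiniteDimensional K A] [Module.Finite A Y] :
    Module.Finite Aᵐᵒᵖ (KDual K Y) := by
  have : FiniteDimensional K Y := Module.Finite.trans A Y
  have : Module.Finite K (KDual K Y) := inferInstanceAs (Module.Finite K (Y →ₗ[K] K))
  exact Module.Finite.of_restrictScalars_finite K Aᵐᵒᵖ _

theorem nonempty_minProjPresentation_kDual [FiniteDimensional K A] [Module.Finite A Y] :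
    Nonempty (MinProjPresentation Aᵐᵒᵖ (KDual K Y)) := by
  have : Module.Finite Aᵐᵒᵖ (KDual K Y) := KDual.finite K A Y
  have : IsArtinianRing Aᵐᵒᵖ := IsArtinianRing.of_finite K Aᵐᵒᵖ
  exact nonempty_minProjPresentation Aᵐᵒᵖ (KDual K Y)

end KDual

/-! ### The transpose, the translation `τ⁻` and the cosyzygy -/

section Transpose

variable {A : Type u} [Ring A]

/-- For a map `f : P ⟶ Q` of right `A`-modules, the map `Hom(f, A) : Hom(Q, A) ⟶ Hom(P, A)` of
left `A`-modules, with `(a • g) q = a * g q`. -/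
def homToRing {P Q : Type u} [AddCommGroup P] [Module Aᵐᵒᵖ P] [AddCommGroup Q] [Module Aᵐᵒᵖ Q]
    (f : P →ₗ[Aᵐᵒᵖ] Q) : (Q →ₗ[Aᵐᵒᵖ] A) →ₗ[A] (P →ₗ[Aᵐᵒᵖ] A) where
  toFun g := g ∘ₗ f
  map_add' _ _ := rfl
  map_smul' _ _ := rfl

/-- The Auslander-Bridger transpose of a right `A`-module, formed from a minimal projective
presentation `P₁ ⟶ P₀ ⟶ M ⟶ 0`: the cokernel of `Hom(P₀, A) ⟶ Hom(P₁, A)`, a left `A`-module. -/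
abbrev MinProjPresentation.transpose {M : Type u} [AddCommGroup M] [Module Aᵐᵒᵖ M]
    (p : MinProjPresentation Aᵐᵒᵖ M) : Type u :=
  (p.P₁.carrier →ₗ[Aᵐᵒᵖ] A) ⧸ LinearMap.range (homToRing p.d)

end Transpose

section Translation

variable (K A : Type u) [Field K] [Ring A] [Algebra K A] [FiniteDimensional K A]
  (Y : Type u) [AddCommGroup Y] [Module K Y] [Module A Y] [IsScalarTower K A Y]
  [Module.Finite A Y]

/-- A chosen injective envelope of `Y`; it is unique up to isomorphism. -/
noncomputable def injEnvelope : InjEnvelope A Y :=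
  Classical.choice (nonempty_injEnvelope K A Y)

/-- The `K`-vector space structure that the injective envelope has as an `A`-module. -/
noncomputable instance injEnvelope.instModuleBase : Module K (injEnvelope K A Y).carrier :=
  Module.compHom (injEnvelope K A Y).carrier (algebraMap K A)

instance injEnvelope.instIsScalarTower : IsScalarTower K A (injEnvelope K A Y).carrier where
  smul_assoc k a m := by
    rw [Algebra.smul_def, mul_smul]
    rfl

/-- The cosyzygy `Ω⁻ Y`, the cokernel of an injective envelope of `Y`. -/
abbrev Cosyzygy : Type u :=
  (injEnvelope K A Y).carrier ⧸ LinearMap.range (injEnvelope K A Y).ι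

/-- A chosen minimal projective presentation of the right module `D Y`; it is unique up to
isomorphism. -/
noncomputable def dualPresentation : MinProjPresentation Aᵐᵒᵖ (KDual K Y) :=
  Classical.choice (nonempty_minProjPresentation_kDual K A Y)

/-- The inverse Auslander-Reiten translation `τ⁻ Y = Tr D Y`. -/
abbrev TauInv : Type u := (dualPresentation K A Y).transpose

/-- The inverse `2`-Auslander-Reiten translation `τ₂⁻ Y = τ⁻ Ω⁻ Y`. -/
abbrev TauInvTwo : Type u := TauInv K A (Cosyzygy K A Y)

end Translation

/-! ### Stable homomorphisms and `Sub X` -/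

section Stable

variable (R : Type u) [Ring R] (M N : Type u) [AddCommGroup M] [Module R M]
  [AddCommGroup N] [Module R N]

/-- The maps `M ⟶ N` that factor through a finitely generated projective module. -/
def projectiveMaps : AddSubgroup (M →ₗ[R] N) where
  carrier := {f | ∃ (P : Type u) (_ : AddCommGroup P) (_ : Module R P),
    Module.Finite R P ∧ Module.Projective R P ∧
      ∃ (g : M →ₗ[R] P) (h : P →ₗ[R] N), f = h ∘ₗ g}
  zero_mem' := ⟨PUnit, inferInstance, inferInstance, inferInstance, inferInstance, 0, 0, by simp⟩
  add_mem' := by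
    rintro _ _ ⟨P, _, _, hP, hP', g, h, rfl⟩ ⟨P₂, _, _, hP₂, hP₂', g₂, h₂, rfl⟩
    exact ⟨P × P₂, inferInstance, inferInstance, inferInstance, inferInstance,
      g.prod g₂, h.coprod h₂, by ext; simp⟩
  neg_mem' := by
    rintro _ ⟨P, _, _, hP, hP', g, h, rfl⟩
    exact ⟨P, inferInstance, inferInstance, hP, hP', g, -h, by ext; simp⟩

/-- The stable Hom group, the quotient of `Hom_R(M, N)` by the maps that factor through a
projective module. -/
abbrev StableHom : Type u := (M →ₗ[R] N) ⧸ projectiveMaps R M N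

/-- `N` belongs to `Sub X`: it is finitely generated and there is a monomorphism `N ⟶ X`. -/
def IsSub (X : Type u) [AddCommGroup X] [Module R X] : Prop :=
  Module.Finite R N ∧ ∃ i : N →ₗ[R] X, Function.Injective i

end Stable

/-!
Two facts carry the proof.

*The transpose has no nonzero projective quotient*
(`MinProjPresentation.subsingleton_of_transpose_surjective`). A projective quotient of
`Tr M = coker (Hom(P₀, A) ⟶ Hom(P₁, A))` is a direct summand of `Hom(P₁, A)`, hence gives an
idempotent of `P₁` whose image lies in the kernel of `P₁ ⟶ P₀`. That kernel is superfluous, so the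
idempotent is zero. Therefore a nonzero map `Tr M ⟶ X` cannot be stably trivial as a map onto its
image `N`: otherwise it would lift to a map from `Tr M` onto the projective cover of `N`. This gives
the equivalence of `Hom(Tr M, X) = 0` with the vanishing of the stable homomorphisms to all `N` in
`Sub X` (`MinProjPresentation.subsingleton_transpose_hom_iff`).

*The Auslander-Reiten formula, as far as vanishing is concerned*
(`MinProjPresentation.subsingleton_ext_one_iff_stableHom`): `Ext¹(N, Z) = 0` if and only if every
map from `τ⁻ Z = Tr D Z` to `N` is stably trivial. Let `0 ⟶ L ⟶ P ⟶ N ⟶ 0` be exact with `P` finite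
free. Then `Ext¹(N, Z) = 0` says that `Hom(P, Z) ⟶ Hom(L, Z)` is onto. Since `Z = D D Z`, this map
is the `K`-dual of `DZ ⊗ L ⟶ DZ ⊗ P`, so it is onto if and only if the latter is injective
(`MinProjPresentation.forall_exists_extend_iff`). On the other side, chasing the squares formed by
`Hom(P₀, A) ⟶ Hom(P₁, A)` and `L ⟶ P` shows that the same injectivity means that all maps
`Tr D Z ⟶ N` lift to `P` (`forall_exists_lift_coker_iff`), that is, are stably trivial. Tensor
products over the noncommutative ring `A` are avoided: for a finitely generated projective right
module `Q`, the group `Hom(Hom(Q, A), L)` stands for `Q ⊗ L`, the maps `evalSMul` being the pure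
tensors.

Dimension shifting along the injective envelope of `Y` turns `Ext²(N, Y)` into `Ext¹(N, Ω⁻ Y)`, and
the theorem follows by taking `Z = Ω⁻ Y`.
-/

/-! ### Vanishing of extension groups as extension properties -/

section ExtVanishing

open CategoryTheory Abelian

variable {A : Type u} [Ring A]

/-- Dimension shifting along an embedding into an injective module. -/
theorem subsingleton_ext_two_iff_ext_one_quotient {N Y I : Type u} [AddCommGroup N] [Module A N]
    [AddCommGroup Y] [Module A Y] [AddCommGroup I] [Module A I] [Module.Injective A I]
    (ι : Y →ₗ[A] I) (hι : Function.Injective ι) :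
    Subsingleton (Ext.{u} (ModuleCat.of A N) (ModuleCat.of A Y) 2) ↔
      Subsingleton (Ext.{u} (ModuleCat.of A N) (ModuleCat.of A (I ⧸ LinearMap.range ι)) 1) := by
  have hS := ModuleCat.shortComplex_shortExact
    (ModuleCat.shortComplexOfCompEqZero ι (LinearMap.range ι).mkQ (LinearMap.range_mkQ_comp ι))
    (fun x => by simp) hι (Submodule.mkQ_surjective _)
  have hI : Injective (ModuleCat.of A I) := Module.injective_object_of_injective_module A I
  constructor <;> intro h
  · refine subsingleton_of_forall_eq 0 fun x => ?_
    obtain ⟨y, rfl⟩ := Ext.covariant_sequence_exact₃ _ hS x rfl (h.elim _ _)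
    rw [Ext.eq_zero_of_injective (I := ModuleCat.of A I) y, Ext.zero_comp]
  · refine subsingleton_of_forall_eq 0 fun x => ?_
    obtain ⟨y, rfl⟩ := Ext.covariant_sequence_exact₁ _ hS x
      (Ext.eq_zero_of_injective (I := ModuleCat.of A I) _) (n₀ := 1) rfl
    rw [h.elim y 0, Ext.zero_comp]

theorem subsingleton_ext_one_iff_forall_exists_extend {N P Z : Type u} [AddCommGroup N]
    [Module A N] [AddCommGroup P] [Module A P] [Module.Projective A P] [AddCommGroup Z]
    [Module A Z] (p : P →ₗ[A] N) (hp : Function.Surjective p) :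
    Subsingleton (Ext.{u} (ModuleCat.of A N) (ModuleCat.of A Z) 1) ↔
      ∀ h : LinearMap.ker p →ₗ[A] Z, ∃ h' : P →ₗ[A] Z, h' ∘ₗ (LinearMap.ker p).subtype = h := by
  have hS := LinearMap.shortExact_shortComplexKer hp
  have hP : Projective (ModuleCat.of A P) :=
    (IsProjective.iff_projective (R := A) P).1 inferInstance
  constructor <;> intro H
  · intro h
    obtain ⟨y, hy⟩ := Ext.contravariant_sequence_exact₁ hS (ModuleCat.of A Z)
      (Ext.mk₀ (ModuleCat.ofHom h)) rfl (H.elim _ _)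
    obtain ⟨g, rfl⟩ := Ext.addEquiv₀.symm.surjective y
    rw [Ext.addEquiv₀_symm_apply, Ext.mk₀_comp_mk₀] at hy
    have := Ext.addEquiv₀.symm.injective (a₁ := _) (a₂ := _) hy
    exact ⟨g.hom, by simpa using congrArg ModuleCat.Hom.hom this⟩
  · refine subsingleton_of_forall_eq 0 fun x => ?_
    obtain ⟨y, rfl⟩ := Ext.contravariant_sequence_exact₃ hS (ModuleCat.of A Z) x
      (Ext.eq_zero_of_projective (P := ModuleCat.of A P) _) (n₀ := 0) rfl
    obtain ⟨g, rfl⟩ := Ext.addEquiv₀.symm.surjective y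
    obtain ⟨h', hh⟩ := H g.hom
    have : g = ModuleCat.ofHom (LinearMap.ker p).subtype ≫ ModuleCat.ofHom h' := by
      ext x
      exact (LinearMap.congr_fun hh x).symm
    rw [this, Ext.addEquiv₀_symm_apply, ← Ext.mk₀_comp_mk₀,
      ← Ext.comp_assoc _ _ _ (a₁₂ := 1) rfl rfl rfl]
    erw [hS.extClass_comp]
    rw [Ext.zero_comp]

end ExtVanishing

/-! ### Stable homomorphisms as liftable homomorphisms -/

section StableLifting

variable {A : Type u} [Ring A]

theorem subsingleton_stableHom_iff_forall_exists_lift {T N P : Type u} [AddCommGroup T]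
    [Module A T] [AddCommGroup N] [Module A N] [AddCommGroup P] [Module A P]
    [Module.Finite A P] [Module.Projective A P] (p : P →ₗ[A] N) (hp : Function.Surjective p) :
    Subsingleton (StableHom A T N) ↔ ∀ f : T →ₗ[A] N, ∃ g : T →ₗ[A] P, p ∘ₗ g = f := by
  have key : Subsingleton (StableHom A T N) ↔ ∀ f, f ∈ projectiveMaps A T N :=
    ⟨fun h f => (QuotientAddGroup.eq_zero_iff f).1 (h.elim _ _), fun h =>
      subsingleton_of_forall_eq 0 fun x => by
        obtain ⟨f, rfl⟩ := QuotientAddGroup.mk_surjective x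
        exact (QuotientAddGroup.eq_zero_iff f).2 (h f)⟩
  rw [key]
  refine forall_congr' fun f => ⟨?_, ?_⟩
  · rintro ⟨Q, _, _, _, _, g, h, rfl⟩
    obtain ⟨k, hk⟩ := Module.projective_lifting_property p h hp
    exact ⟨k ∘ₗ g, by rw [← LinearMap.comp_assoc, hk]⟩
  · rintro ⟨g, rfl⟩
    exact ⟨P, _, _, inferInstance, inferInstance, g, p, rfl⟩

/-- All maps from the cokernel of `c : Q₀ ⟶ Q₁` to `N` lift along `p` if and only if in every square
from `c` to `ker p ⟶ P` the map `Q₀ ⟶ ker p` extends along `c`. Indeed a map from the cokernel to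
`N` lifts to `Q₁ ⟶ P`, whose restriction to `Q₀` lands in `ker p`, and an extension `Q₁ ⟶ ker p` of
that restriction is what has to be subtracted for the lift to descend to the cokernel. -/
theorem forall_exists_lift_coker_iff {Q₀ Q₁ N P : Type*} [AddCommGroup Q₀] [Module A Q₀]
    [AddCommGroup Q₁] [Module A Q₁] [Module.Projective A Q₁] [AddCommGroup N] [Module A N]
    [AddCommGroup P] [Module A P] (c : Q₀ →ₗ[A] Q₁) (p : P →ₗ[A] N)
    (hp : Function.Surjective p) :
    (∀ f : (Q₁ ⧸ LinearMap.range c) →ₗ[A] N,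
        ∃ g : (Q₁ ⧸ LinearMap.range c) →ₗ[A] P, p ∘ₗ g = f) ↔
      ∀ (v : Q₀ →ₗ[A] LinearMap.ker p) (u : Q₁ →ₗ[A] P),
        u ∘ₗ c = (LinearMap.ker p).subtype ∘ₗ v → ∃ w : Q₁ →ₗ[A] LinearMap.ker p, w ∘ₗ c = v := by
  constructor
  · intro H v u huv
    have hpu : LinearMap.range c ≤ LinearMap.ker (p ∘ₗ u) := by
      rintro _ ⟨x, rfl⟩
      have := LinearMap.congr_fun huv x
      simp only [LinearMap.comp_apply] at this
      simp [this]
    obtain ⟨g, hg⟩ := H ((LinearMap.range c).liftQ (p ∘ₗ u) hpu)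
    -- The difference of the two lifts of `Q₁ ⟶ N` takes its values in `ker p`.
    refine ⟨(u - g ∘ₗ (LinearMap.range c).mkQ).codRestrict _ fun x => ?_, ?_⟩
    · have : p (g ((LinearMap.range c).mkQ x)) = p (u x) :=
        LinearMap.congr_fun hg ((LinearMap.range c).mkQ x)
      rw [LinearMap.mem_ker, LinearMap.sub_apply, map_sub, LinearMap.comp_apply, this, sub_self]
    · refine LinearMap.ext fun x => Subtype.ext ?_
      have h0 : (LinearMap.range c).mkQ (c x) = 0 := (Submodule.Quotient.mk_eq_zero _).2 ⟨x, rfl⟩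
      change u (c x) - g ((LinearMap.range c).mkQ (c x)) = v x
      rw [h0, map_zero, sub_zero]
      exact LinearMap.congr_fun huv x
  · intro H f
    obtain ⟨u, hu⟩ := Module.projective_lifting_property p (f ∘ₗ (LinearMap.range c).mkQ) hp
    have hu' : ∀ x, p (u x) = f ((LinearMap.range c).mkQ x) := fun x => LinearMap.congr_fun hu x
    have h0 : ∀ x, (LinearMap.range c).mkQ (c x) = 0 := fun x =>
      (Submodule.Quotient.mk_eq_zero _).2 ⟨x, rfl⟩
    obtain ⟨w, hw⟩ := H ((u ∘ₗ c).codRestrict _ fun x => by simp [hu', -Submodule.mkQ_apply, h0]) u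
      (by ext; rfl)
    refine ⟨(LinearMap.range c).liftQ (u - (LinearMap.ker p).subtype ∘ₗ w) ?_, ?_⟩
    · rintro _ ⟨x, rfl⟩
      have : (w (c x) : P) = u (c x) := congrArg Subtype.val (LinearMap.congr_fun hw x)
      simp [this]
    · ext x
      simp [hu']

end StableLifting

/-! ### Duals of finitely generated projective right modules -/

section RightDual

variable {A : Type u} [Ring A] {P : Type u} [AddCommGroup P] [Module Aᵐᵒᵖ P]

/-- The dual basis lemma for right modules. -/
theorem exists_rightDualBasis [Module.Finite Aᵐᵒᵖ P] [Module.Projective Aᵐᵒᵖ P] :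
    ∃ (n : ℕ) (x : Fin n → P) (f : Fin n → P →ₗ[Aᵐᵒᵖ] A),
      ∀ y, ∑ i, MulOpposite.op (f i y) • x i = y := by
  obtain ⟨n, s, t, -, -, hst⟩ := Module.Finite.exists_comp_eq_id_of_projective Aᵐᵒᵖ P
  refine ⟨n, fun i => s (Pi.single i 1), fun i =>
    { toFun := fun y => (t y i).unop
      map_add' := fun y z => by simp
      map_smul' := fun a y => by simp }, fun y => ?_⟩
  have h := LinearMap.congr_fun hst y
  simp only [LinearMap.comp_apply, LinearMap.id_apply] at h
  conv_rhs => rw [← h, pi_eq_sum_univ' (t y), map_sum]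
  simp [map_smul]

variable (A) in
/-- For `x : P` and `l : L`, the map `Hom(P, A) ⟶ L` with `f ↦ f x • l`. For a finitely generated
projective `P` it is the element of `Hom(Hom(P, A), L)` that corresponds to the pure tensor
`x ⊗ l` of `P ⊗ L`. -/
def evalSMul {L : Type*} [AddCommGroup L] [Module A L] (x : P) (l : L) :
    (P →ₗ[Aᵐᵒᵖ] A) →ₗ[A] L where
  toFun f := f x • l
  map_add' f g := by simp [add_smul]
  map_smul' a f := by simp [mul_smul]

section evalSMul

variable {L L' : Type*} [AddCommGroup L] [Module A L] [AddCommGroup L'] [Module A L']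

@[simp]
theorem evalSMul_apply (x : P) (l : L) (f : P →ₗ[Aᵐᵒᵖ] A) : evalSMul A x l f = f x • l := rfl

theorem evalSMul_add_left (x y : P) (l : L) :
    evalSMul A (x + y) l = evalSMul A x l + evalSMul A y l := by
  ext f; simp [add_smul]

theorem evalSMul_add_right (x : P) (l m : L) :
    evalSMul A x (l + m) = evalSMul A x l + evalSMul A x m := by
  ext f; simp

theorem evalSMul_smul_right (x : P) (a : A) (l : L) :
    evalSMul A x (a • l) = evalSMul A (MulOpposite.op a • x) l := by
  ext f; simp [mul_smul]

theorem comp_evalSMul (i : L →ₗ[A] L') (x : P) (l : L) :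
    i ∘ₗ evalSMul A x l = evalSMul A x (i l) := by
  ext f; simp

theorem evalSMul_comp_homToRing {Q : Type u} [AddCommGroup Q] [Module Aᵐᵒᵖ Q]
    (d : Q →ₗ[Aᵐᵒᵖ] P) (y : Q) (l : L) :
    evalSMul A y l ∘ₗ homToRing d = evalSMul A (d y) l := rfl

theorem sum_smul_rightDualBasis {n : ℕ} {x : Fin n → P} {f : Fin n → P →ₗ[Aᵐᵒᵖ] A}
    (h : ∀ y, ∑ i, MulOpposite.op (f i y) • x i = y) (g : P →ₗ[Aᵐᵒᵖ] A) :
    ∑ i, g (x i) • f i = g := by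
  ext y
  conv_rhs => rw [← h y, map_sum]
  simp

theorem sum_evalSMul_rightDualBasis {n : ℕ} {x : Fin n → P} {f : Fin n → P →ₗ[Aᵐᵒᵖ] A}
    (h : ∀ y, ∑ i, MulOpposite.op (f i y) • x i = y) (v : (P →ₗ[Aᵐᵒᵖ] A) →ₗ[A] L) :
    ∑ i, evalSMul A (x i) (v (f i)) = v := by
  ext g
  conv_rhs => rw [← sum_smul_rightDualBasis h g, map_sum]
  simp

end evalSMul

theorem projective_rightDual [Module.Finite Aᵐᵒᵖ P] [Module.Projective Aᵐᵒᵖ P] :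
    Module.Projective A (P →ₗ[Aᵐᵒᵖ] A) := by
  obtain ⟨n, x, f, h⟩ := exists_rightDualBasis (A := A) (P := P)
  refine Module.Projective.of_split (M := Fin n → A)
    { toFun := fun g i => g (x i), map_add' := fun _ _ => rfl, map_smul' := fun _ _ => rfl }
    (Fintype.linearCombination A f) ?_
  ext1 g
  simpa [Fintype.linearCombination_apply] using sum_smul_rightDualBasis h g

/-- Every endomorphism of `Hom(P, A)` is the transpose of an endomorphism of `P`. -/
theorem exists_homToRing_eq [Module.Finite Aᵐᵒᵖ P] [Module.Projective Aᵐᵒᵖ P]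
    (θ : (P →ₗ[Aᵐᵒᵖ] A) →ₗ[A] (P →ₗ[Aᵐᵒᵖ] A)) :
    ∃ ε : P →ₗ[Aᵐᵒᵖ] P, homToRing ε = θ := by
  obtain ⟨n, x, f, h⟩ := exists_rightDualBasis (A := A) (P := P)
  refine ⟨{ toFun := fun y => ∑ i, MulOpposite.op (θ (f i) y) • x i
            map_add' := fun y z => by simp [add_smul, Finset.sum_add_distrib]
            map_smul' := fun a y => by simp [Finset.smul_sum, mul_smul] }, ?_⟩
  ext g y
  conv_rhs => rw [← sum_smul_rightDualBasis h g, map_sum]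
  simp [homToRing]

/-- The functionals on a finitely generated projective module separate points. -/
theorem eq_of_forall_rightDual_eq [Module.Finite Aᵐᵒᵖ P] [Module.Projective Aᵐᵒᵖ P] {x y : P}
    (hxy : ∀ g : P →ₗ[Aᵐᵒᵖ] A, g x = g y) : x = y := by
  obtain ⟨n, e, f, h⟩ := exists_rightDualBasis (A := A) (P := P)
  rw [← h x, ← h y]
  simp [hxy]

end RightDual

/-! ### The transpose has no nonzero projective quotient -/

section Transpose

variable {A : Type u} [Ring A] {M : Type u} [AddCommGroup M] [Module Aᵐᵒᵖ M]

/-- A projective quotient of the transpose splits off `Hom(P₁, A)`. The corresponding idempotent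
of `P₁` has its image in the superfluous kernel of `P₁ ⟶ P₀`, hence is zero. -/
theorem MinProjPresentation.subsingleton_of_transpose_surjective (p : MinProjPresentation Aᵐᵒᵖ M)
    {Q : Type*} [AddCommGroup Q] [Module A Q] [Module.Projective A Q]
    (s : p.transpose →ₗ[A] Q) (hs : Function.Surjective s) : Subsingleton Q := by
  set q := s ∘ₗ (LinearMap.range (homToRing p.d)).mkQ with hq
  have hqs : Function.Surjective q := hs.comp (Submodule.mkQ_surjective _)
  obtain ⟨j, hj⟩ := Module.projective_lifting_property q LinearMap.id hqs
  have hj' : ∀ y, q (j y) = y := fun y => LinearMap.congr_fun hj y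
  have hqd : ∀ g, q (homToRing p.d g) = 0 := fun g => by
    have : (LinearMap.range (homToRing p.d)).mkQ (homToRing p.d g) = 0 :=
      (Submodule.Quotient.mk_eq_zero _).2 ⟨g, rfl⟩
    rw [hq, LinearMap.comp_apply, this, map_zero]
  obtain ⟨ε, hε⟩ := exists_homToRing_eq (j ∘ₗ q)
  have hε' : ∀ g x, g (ε x) = j (q g) x := fun g x =>
    LinearMap.congr_fun (LinearMap.congr_fun hε g) x
  -- `ε` is the idempotent of `P₁` whose transpose projects `Hom(P₁, A)` onto the copy of `Q`.
  have hidem : ∀ x, ε (ε x) = ε x := fun x => eq_of_forall_rightDual_eq (A := A) fun g => by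
    rw [hε', hε', hε', hj']
  have hker : ∀ x, ε x ∈ LinearMap.ker p.P₁.π := fun x => by
    rw [LinearMap.mem_ker]
    apply Subtype.ext
    change p.d (ε x) = 0
    refine eq_of_forall_rightDual_eq (A := A) fun g => ?_
    change (homToRing p.d g) (ε x) = _
    rw [hε', hqd]
    simp
  have htop : LinearMap.range (LinearMap.id - ε) = ⊤ := by
    refine p.P₁.superfluous _ (eq_top_iff.2 fun x _ => ?_)
    exact Submodule.mem_sup.2 ⟨x - ε x, ⟨x, rfl⟩, ε x, hker x, by simp⟩
  have hzero : ∀ x, ε x = 0 := fun x => by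
    obtain ⟨y, rfl⟩ : x ∈ LinearMap.range (LinearMap.id - ε) := htop ▸ trivial
    simp [hidem]
  refine subsingleton_of_forall_eq 0 fun y => ?_
  have hjy : j y = 0 := by
    ext x
    have := hε' (j y) x
    rw [hj', hzero, map_zero] at this
    simp [← this]
  rw [← hj' y, hjy, map_zero]

end Transpose

/-! ### Functionals on `Hom(Hom(P, A), L)` -/

section Forms

variable {K A : Type u} [Field K] [Ring A] [Algebra K A] {P : Type u} [AddCommGroup P]
  [Module Aᵐᵒᵖ P] {L : Type*} [AddCommGroup L] [Module K L] [Module A L] [IsScalarTower K A L]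
  {Z : Type u} [AddCommGroup Z] [Module K Z] [Module A Z] [IsScalarTower K A Z]

variable (K Z) in
/-- The identification of `KDual K Z` with the dual space of `Z`. -/
def KDual.toDual : KDual K Z ≃ₗ[K] Module.Dual K Z := LinearEquiv.refl K (Module.Dual K Z)

theorem KDual.toDual_smul (a : Aᵐᵒᵖ) (m : KDual K Z) (z : Z) :
    KDual.toDual K Z (a • m) z = KDual.toDual K Z m (a.unop • z) := rfl

theorem dual_ext_evalSMul [Module.Finite Aᵐᵒᵖ P] [Module.Projective Aᵐᵒᵖ P]
    {φ ψ : ((P →ₗ[Aᵐᵒᵖ] A) →ₗ[A] L) →ₗ[K] K}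
    (h : ∀ x l, φ (evalSMul A x l) = ψ (evalSMul A x l)) : φ = ψ := by
  obtain ⟨n, x, f, hx⟩ := exists_rightDualBasis (A := A) (P := P)
  ext v
  rw [← sum_evalSMul_rightDualBasis hx v, map_sum, map_sum]
  simp [h]

/-- The functional on `Hom(Hom(P, A), L)`, that is on `P ⊗ L`, which a map `h : L ⟶ Z` defines
by way of `π : P ⟶ D Z`: the trace of `π` and `h`. -/
theorem exists_dual_of_hom [Module.Finite Aᵐᵒᵖ P] [Module.Projective Aᵐᵒᵖ P]
    (π : P →ₗ[Aᵐᵒᵖ] KDual K Z) (h : L →ₗ[A] Z) :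
    ∃ φ : ((P →ₗ[Aᵐᵒᵖ] A) →ₗ[A] L) →ₗ[K] K,
      ∀ x l, φ (evalSMul A x l) = KDual.toDual K Z (π x) (h l) := by
  obtain ⟨n, x, f, hx⟩ := exists_rightDualBasis (A := A) (P := P)
  refine ⟨
    { toFun := fun v => ∑ i, KDual.toDual K Z (π (x i)) (h (v (f i)))
      map_add' := fun v w => by simp [Finset.sum_add_distrib]
      map_smul' := fun k v => by
        have (l : L) : h (k • l) = k • h l := LinearMap.map_smul_of_tower h k l
        simp [this, Finset.mul_sum] }, fun y l => ?_⟩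
  conv_rhs => rw [← hx y, map_sum, map_sum, LinearMap.sum_apply]
  simp [KDual.toDual_smul]

/-- Conversely, a functional on `P ⊗ L` that vanishes on `ker π ⊗ L` comes from a map `L ⟶ Z`,
because `Z` is its own double dual. -/
theorem exists_hom_of_dual [FiniteDimensional K Z] (π : P →ₗ[Aᵐᵒᵖ] KDual K Z)
    (hπ : Function.Surjective π) (φ : ((P →ₗ[Aᵐᵒᵖ] A) →ₗ[A] L) →ₗ[K] K)
    (hφ : ∀ x l, π x = 0 → φ (evalSMul A x l) = 0) :
    ∃ h : L →ₗ[A] Z, ∀ x l, KDual.toDual K Z (π x) (h l) = φ (evalSMul A x l) := by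
  have hwd : ∀ x y l, π x = π y → φ (evalSMul A x l) = φ (evalSMul A y l) := fun x y l hxy => by
    have := hφ (x - y) l (by rw [map_sub, hxy, sub_self])
    rw [eq_add_of_sub_eq' (a := x) (b := y) rfl, evalSMul_add_left, map_add, this, add_zero]
  have key : ∀ l, ∃ z : Z, ∀ x, KDual.toDual K Z (π x) z = φ (evalSMul A x l) := fun l => by
    -- `x ↦ φ (x ⊗ l)` descends to a functional on `D Z`, that is, evaluation at an element of `Z`.
    let x : Module.Dual K Z → P := fun m => Function.surjInv hπ ((KDual.toDual K Z).symm m)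
    have hx : ∀ m, π (x m) = (KDual.toDual K Z).symm m := fun m => Function.surjInv_eq hπ _
    let β : Module.Dual K (Module.Dual K Z) :=
      { toFun := fun m => φ (evalSMul A (x m) l)
        map_add' := fun m m' => by
          rw [← map_add, ← evalSMul_add_left]
          exact hwd _ _ _ (by simp only [map_add, hx])
        map_smul' := fun k m => by
          have : k • evalSMul A (x m) l =
              evalSMul A (MulOpposite.op (algebraMap K A k) • x m) l := by
            rw [← evalSMul_smul_right]
            ext f
            simp [smul_comm k]
          rw [RingHom.id_apply, ← map_smul, this]
          refine hwd _ _ _ ?_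
          rw [map_smul, hx, hx, map_smul]
          apply (KDual.toDual K Z).injective
          ext z
          simp [KDual.toDual_smul] }
    refine ⟨(Module.evalEquiv K Z).symm β, fun y => ?_⟩
    rw [Module.apply_evalEquiv_symm_apply]
    exact hwd _ _ _ (by rw [hx, LinearEquiv.symm_apply_apply])
  choose h hh using key
  have sep : ∀ z z' : Z, (∀ x, KDual.toDual K Z (π x) z = KDual.toDual K Z (π x) z') →
      z = z' := fun z z' H => by
    rw [← sub_eq_zero, ← Module.forall_dual_apply_eq_zero_iff K]
    intro m
    obtain ⟨x, hx⟩ := hπ ((KDual.toDual K Z).symm m)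
    have := H x
    rw [hx, LinearEquiv.apply_symm_apply] at this
    rw [map_sub, this, sub_self]
  refine ⟨{ toFun := h, map_add' := fun l m => ?_, map_smul' := fun a l => ?_ },
    fun x l => hh l x⟩
  · refine sep _ _ fun x => ?_
    rw [map_add, hh, hh, hh, evalSMul_add_right, map_add]
  · refine sep _ _ fun x => ?_
    rw [hh, evalSMul_smul_right, ← hh, map_smul, KDual.toDual_smul]
    rfl

end Forms

/-! ### The Auslander-Reiten formula, on the level of vanishing -/

section AuslanderReiten

variable {K A : Type u} [Field K] [Ring A] [Algebra K A]
  {Z : Type u} [AddCommGroup Z] [Module K Z] [Module A Z] [IsScalarTower K A Z]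

/-- A functional on `V` that vanishes on the preimage of `W' ⊆ W` under `i : V ⟶ W` is the pullback
of a functional on `W` that vanishes on `W'`. -/
theorem exists_dual_comp_eq_of_comap_le_ker {V W : Type*} [AddCommGroup V] [Module K V]
    [AddCommGroup W] [Module K W] (i : V →ₗ[K] W) (W' : Submodule K W) (φ : V →ₗ[K] K)
    (h : ∀ v, i v ∈ W' → φ v = 0) :
    ∃ ψ : W →ₗ[K] K, ψ ∘ₗ i = φ ∧ ∀ w ∈ W', ψ w = 0 := by
  have hφ : φ ∈ LinearMap.range (W'.mkQ ∘ₗ i).dualMap := by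
    rw [LinearMap.range_dualMap_eq_dualAnnihilator_ker, Submodule.mem_dualAnnihilator]
    exact fun v hv => h v (by simpa using hv)
  obtain ⟨ψ, hψ⟩ := hφ
  exact ⟨ψ ∘ₗ W'.mkQ, hψ, fun w hw => by simp [(Submodule.Quotient.mk_eq_zero W').2 hw]⟩

theorem MinProjPresentation.π_d {R M : Type u} [Ring R] [AddCommGroup M] [Module R M]
    (p : MinProjPresentation R M) (y : p.P₁.carrier) : p.P₀.π (p.d y) = 0 :=
  LinearMap.mem_ker.1 (p.P₁.π y).2

theorem MinProjPresentation.exists_d_eq {R M : Type u} [Ring R] [AddCommGroup M] [Module R M]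
    (p : MinProjPresentation R M) {x : p.P₀.carrier} (hx : p.P₀.π x = 0) : ∃ y, p.d y = x := by
  obtain ⟨y, hy⟩ := p.P₁.surjective ⟨x, hx⟩
  exact ⟨y, congrArg Subtype.val hy⟩

/-- Precomposition with `Hom(d, A)`, the map that `d ⊗ L` corresponds to. -/
def precompHomToRing (K : Type u) [Field K] [Algebra K A] {P Q : Type u} [AddCommGroup P]
    [Module Aᵐᵒᵖ P] [AddCommGroup Q] [Module Aᵐᵒᵖ Q] (d : Q →ₗ[Aᵐᵒᵖ] P) (L : Type*)
    [AddCommGroup L] [Module K L] [Module A L] [IsScalarTower K A L] :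
    ((Q →ₗ[Aᵐᵒᵖ] A) →ₗ[A] L) →ₗ[K] ((P →ₗ[Aᵐᵒᵖ] A) →ₗ[A] L) where
  toFun w := w ∘ₗ homToRing d
  map_add' _ _ := rfl
  map_smul' _ _ := rfl

/-- The functional defined by a map `L ⟶ Z` vanishes on the image of `P₁ ⊗ L`. -/
theorem MinProjPresentation.dual_comp_homToRing_eq_zero (p : MinProjPresentation Aᵐᵒᵖ (KDual K Z))
    {L : Type*} [AddCommGroup L] [Module K L] [Module A L] [IsScalarTower K A L] {h : L →ₗ[A] Z}
    {φ : ((p.P₀.carrier →ₗ[Aᵐᵒᵖ] A) →ₗ[A] L) →ₗ[K] K}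
    (hφ : ∀ x l, φ (evalSMul A x l) = KDual.toDual K Z (p.P₀.π x) (h l))
    (w : (p.P₁.carrier →ₗ[Aᵐᵒᵖ] A) →ₗ[A] L) : φ (w ∘ₗ homToRing p.d) = 0 := by
  have : φ ∘ₗ precompHomToRing K p.d L = 0 := dual_ext_evalSMul fun y l => by
    change φ (evalSMul A y l ∘ₗ homToRing p.d) = 0
    rw [evalSMul_comp_homToRing, hφ, p.π_d]
    simp
  exact LinearMap.congr_fun this w

/-- Maps into `Z` extend along `L ⟶ P` if and only if `DZ ⊗ L ⟶ DZ ⊗ P` is injective: the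
extension problem is the `K`-dual of that map. The right hand side spells out the injectivity, where
`DZ ⊗ L` is the cokernel of `Hom(Hom(P₁, A), L) ⟶ Hom(Hom(P₀, A), L)`. -/
theorem MinProjPresentation.forall_exists_extend_iff [FiniteDimensional K Z]
    (p : MinProjPresentation Aᵐᵒᵖ (KDual K Z)) {L P : Type*}
    [AddCommGroup L] [Module K L] [Module A L] [IsScalarTower K A L]
    [AddCommGroup P] [Module K P] [Module A P] [IsScalarTower K A P] (i : L →ₗ[A] P) :
    (∀ h : L →ₗ[A] Z, ∃ h' : P →ₗ[A] Z, h' ∘ₗ i = h) ↔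
      ∀ (v : (p.P₀.carrier →ₗ[Aᵐᵒᵖ] A) →ₗ[A] L) (u : (p.P₁.carrier →ₗ[Aᵐᵒᵖ] A) →ₗ[A] P),
        u ∘ₗ homToRing p.d = i ∘ₗ v →
          ∃ w : (p.P₁.carrier →ₗ[Aᵐᵒᵖ] A) →ₗ[A] L, w ∘ₗ homToRing p.d = v := by
  let I : ((p.P₀.carrier →ₗ[Aᵐᵒᵖ] A) →ₗ[A] L) →ₗ[K] ((p.P₀.carrier →ₗ[Aᵐᵒᵖ] A) →ₗ[A] P) :=
    { toFun := fun v => i ∘ₗ v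
      map_add' := fun v w => LinearMap.comp_add v w i
      map_smul' := fun k v => LinearMap.ext fun f => LinearMap.map_smul_of_tower i k (v f) }
  constructor
  · intro H v u huv
    by_contra hv
    -- Separate `v` from the image of `P₁ ⊗ L` by a functional, which comes from a map `L ⟶ Z`.
    obtain ⟨φ, hφv, hφ⟩ := Submodule.exists_le_ker_of_notMem (K := K)
      (p := LinearMap.range (precompHomToRing K p.d L)) (v := v) hv
    have hφ0 : ∀ w, φ (w ∘ₗ homToRing p.d) = 0 := fun w => hφ ⟨w, rfl⟩
    obtain ⟨h, hh⟩ := exists_hom_of_dual p.P₀.π p.P₀.surjective φ fun x l hx => by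
      obtain ⟨y, rfl⟩ := p.exists_d_eq hx
      rw [← evalSMul_comp_homToRing, hφ0]
    obtain ⟨h', rfl⟩ := H h
    obtain ⟨ψ, hψ⟩ := exists_dual_of_hom p.P₀.π h'
    have hψφ : ψ ∘ₗ I = φ := dual_ext_evalSMul fun x l => by
      change ψ (i ∘ₗ evalSMul A x l) = _
      rw [comp_evalSMul, hψ, ← hh]
      rfl
    apply hφv
    rw [← hψφ]
    change ψ (i ∘ₗ v) = 0
    rw [← huv, p.dual_comp_homToRing_eq_zero hψ]
  · intro H h
    obtain ⟨φ, hφ⟩ := exists_dual_of_hom p.P₀.π h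
    -- Injectivity of `DZ ⊗ L ⟶ DZ ⊗ P` allows the functional of `h` to be extended to `DZ ⊗ P`.
    obtain ⟨ψ, hψφ, hψ⟩ := exists_dual_comp_eq_of_comap_le_ker I
      (LinearMap.range (precompHomToRing K p.d P)) φ (by
        rintro v ⟨u, hu⟩
        obtain ⟨w, rfl⟩ := H v u hu
        exact p.dual_comp_homToRing_eq_zero hφ w)
    obtain ⟨h', hh'⟩ := exists_hom_of_dual p.P₀.π p.P₀.surjective ψ fun x l hx => by
      obtain ⟨y, rfl⟩ := p.exists_d_eq hx
      exact hψ _ ⟨evalSMul A y l, rfl⟩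
    refine ⟨h', LinearMap.ext fun l => ?_⟩
    rw [← sub_eq_zero, ← Module.forall_dual_apply_eq_zero_iff K]
    intro m
    obtain ⟨x, hx⟩ := p.P₀.surjective ((KDual.toDual K Z).symm m)
    have h1 := hh' x (i l)
    rw [← comp_evalSMul] at h1
    have h2 := LinearMap.congr_fun hψφ (evalSMul A x l)
    change ψ (i ∘ₗ evalSMul A x l) = _ at h2
    rw [h2, hφ, hx, LinearEquiv.apply_symm_apply] at h1
    rw [map_sub, LinearMap.comp_apply, h1, sub_self]

/-- The vanishing form of the Auslander-Reiten formula `D Ext¹(N, Z) ≅ \underline{Hom}(τ⁻ Z, N)`. -/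
theorem MinProjPresentation.subsingleton_ext_one_iff_stableHom [FiniteDimensional K Z]
    (p : MinProjPresentation Aᵐᵒᵖ (KDual K Z)) (N : Type u) [AddCommGroup N] [Module A N]
    [Module.Finite A N] :
    Subsingleton (CategoryTheory.Abelian.Ext.{u} (ModuleCat.of A N) (ModuleCat.of A Z) 1) ↔
      Subsingleton (StableHom A p.transpose N) := by
  obtain ⟨n, q, hq⟩ := Module.Finite.exists_fin' A N
  have : Module.Projective A (p.P₁.carrier →ₗ[Aᵐᵒᵖ] A) := projective_rightDual
  rw [subsingleton_ext_one_iff_forall_exists_extend q hq, p.forall_exists_extend_iff,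
    subsingleton_stableHom_iff_forall_exists_lift q hq, forall_exists_lift_coker_iff _ q hq]

end AuslanderReiten

/-! ### Homomorphisms and stable homomorphisms out of the transpose -/

section Homs

variable {A : Type u} [Ring A] {M : Type u} [AddCommGroup M] [Module Aᵐᵒᵖ M]

/-- A stably trivial epimorphism from the transpose lifts to the projective cover of its target, and
the lift is onto, so that the projective cover is zero. -/
theorem MinProjPresentation.subsingleton_of_transpose_surjective_of_stableHom [IsArtinianRing A]
    (p : MinProjPresentation Aᵐᵒᵖ M) {N : Type u} [AddCommGroup N] [Module A N]
    [Module.Finite A N] (h : Subsingleton (StableHom A p.transpose N))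
    (f : p.transpose →ₗ[A] N) (hf : Function.Surjective f) : Subsingleton N := by
  obtain ⟨C⟩ := nonempty_projCover A N
  obtain ⟨g, rfl⟩ := (subsingleton_stableHom_iff_forall_exists_lift C.π C.surjective).1 h f
  have hg : LinearMap.range g = ⊤ := C.superfluous _ (eq_top_iff.2 fun x _ => by
    obtain ⟨t, ht⟩ := hf (C.π x)
    exact Submodule.mem_sup.2 ⟨g t, ⟨t, rfl⟩, x - g t, by
      rw [LinearMap.mem_ker, map_sub, ← ht, LinearMap.comp_apply, sub_self], by simp⟩)
  have := p.subsingleton_of_transpose_surjective g (LinearMap.range_eq_top.1 hg)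
  exact C.surjective.subsingleton

theorem MinProjPresentation.subsingleton_transpose_hom_iff [IsArtinianRing A]
    (p : MinProjPresentation Aᵐᵒᵖ M) (X : Type u) [AddCommGroup X] [Module A X]
    [Module.Finite A X] :
    Subsingleton (p.transpose →ₗ[A] X) ↔
      ∀ (N : Type u) [AddCommGroup N] [Module A N], IsSub A N X →
        Subsingleton (StableHom A p.transpose N) := by
  constructor
  · rintro h N _ _ ⟨-, i, hi⟩
    have : Subsingleton (p.transpose →ₗ[A] N) := ⟨fun f g => LinearMap.ext fun x =>
      hi (LinearMap.congr_fun (h.elim (i ∘ₗ f) (i ∘ₗ g)) x)⟩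
    exact (QuotientAddGroup.mk_surjective (s := projectiveMaps A p.transpose N)).subsingleton
  · intro h
    refine subsingleton_of_forall_eq 0 fun f => ?_
    have hN : Module.Finite A (LinearMap.range f) := inferInstance
    have := p.subsingleton_of_transpose_surjective_of_stableHom
      (h (LinearMap.range f) ⟨hN, _, (LinearMap.range f).injective_subtype⟩) f.rangeRestrict
      f.surjective_rangeRestrict
    refine LinearMap.ext fun x => ?_
    exact congrArg Subtype.val (this.elim (f.rangeRestrict x) 0)

end Homs

theorem mainTheorem3 (K A : Type u) [Field K] [Ring A] [Algebra K A] [FiniteDimensional K A]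
    (X Y : Type u) [AddCommGroup X] [Module A X] [Module.Finite A X]
    [AddCommGroup Y] [Module K Y] [Module A Y] [IsScalarTower K A Y] [Module.Finite A Y] :
    List.TFAE
      [ Subsingleton (TauInvTwo K A Y →ₗ[A] X),
        ∀ (N : Type u) [AddCommGroup N] [Module A N], IsSub A N X →
          Subsingleton (StableHom A (TauInvTwo K A Y) N),
        ∀ (N : Type u) [AddCommGroup N] [Module A N], IsSub A N X →
          Subsingleton
            (CategoryTheory.Abelian.Ext.{u} (ModuleCat.of A N) (ModuleCat.of A Y) 2) ] := by
  have : IsArtinianRing A := IsArtinianRing.of_finite K A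
  have : FiniteDimensional K (Cosyzygy K A Y) := Module.Finite.trans A _
  tfae_have 1 ↔ 2 :=
    (dualPresentation K A (Cosyzygy K A Y)).subsingleton_transpose_hom_iff X
  tfae_have 2 ↔ 3 := by
    refine forall_congr' fun N => forall_congr' fun _ => forall_congr' fun _ =>
      forall_congr' fun hN => ?_
    have := hN.1
    rw [subsingleton_ext_two_iff_ext_one_quotient (injEnvelope K A Y).ι
      (injEnvelope K A Y).injective,
      (dualPresentation K A (Cosyzygy K A Y)).subsingleton_ext_one_iff_stableHom N]
  tfae_finish
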